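/- Let $\mathbb{D}$ be the open unit disc and let $m$ be normalized Lebesgue measure on the unit circle $\partial\mathbb{D}$. An inner function is an analytic mapping $f\colon\mathbb{D}\to\mathbb{D}$ whose radial limit $f(z)=\lim_{r\to1^-}f(rz)$ exists and has modulus one at $m$-almost every $z\in\partial\mathbb{D}$; it thus induces a boundary mapping of $\partial\mathbb{D}$ into itself, defined almost everywhere and also denoted by $f$. For a positive integer $n$, $f^n$ denotes the $n$-th iterate of $f$ (the $n$-fold composition, not the power). **Theorem.** Let $f$ be an inner function with $f(0)=0$ and let $(a_n)$ be a sequence of complex numbers. Let $\mathcal{A}_1,\dots,\mathcal{A}_p$ be finite sets of positive integers such that $$\max\{n : n\in\mathcal{A}_k\}<\min\{n : n\in\mathcal{A}_{k+1}\},\qquad k=1,\dots,p-1,$$ and put $\xi_k=\sum_{n\in\mathcal{A}_k}a_nf^n$, as a function defined $m$-almost everywhere on $\partial\mathbb{D}$. Then $$\int_{\partial\mathbb{D}}\prod_{k=1}^p|\xi_k|^2\,dm=\prod_{k=1}^p\int_{\partial\mathbb{D}}|\xi_k|^2\,dm,$$ where all the functions being integrated are $m$-integrable. -/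

import Mathlib

open MeasureTheory Filter Topology

namespace InnerIterates

/-- Normalized Lebesgue (arc length) measure `m` on the unit circle `∂𝔻 ⊆ ℂ`, as a measure on `ℂ`:
the image of `dθ / (2π)` on `(0, 2π]` under `θ ↦ exp (i θ)`. -/
noncomputable def circleMeasure : Measure ℂ :=
  ((ENNReal.ofReal (2 * Real.pi))⁻¹ • (volume.restrict (Set.Ioc 0 (2 * Real.pi)) : Measure ℝ)).map
    (circleMap 0 1)

/-- `f` is an inner function: an analytic map of the open unit disc into itself whose radial limit
exists and has modulus one at almost every point of the unit circle. -/
structure IsInner (f : ℂ → ℂ) : Prop where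
  analytic : DifferentiableOn ℂ f (Metric.ball 0 1)
  mapsTo : Set.MapsTo f (Metric.ball 0 1) (Metric.ball 0 1)
  radial : ∀ᵐ z ∂circleMeasure, ∃ w : ℂ, ‖w‖ = 1 ∧
    Tendsto (fun r : ℝ => f ((r : ℂ) * z)) (𝓝[<] 1) (𝓝 w)

/-- The boundary mapping `z ↦ lim_{r → 1⁻} f (r z)` (with a junk value where the limit does not
exist; for an inner function this is a null set of the unit circle). -/
noncomputable def boundaryMap (f : ℂ → ℂ) (z : ℂ) : ℂ :=
  limUnder (𝓝[<] (1 : ℝ)) (fun r : ℝ => f ((r : ℂ) * z))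

/-- `ξ(A) = ∑_{n ∈ A} a_n f^n` on the unit circle, `f^n` being the `n`-th iterate of the
boundary mapping of `f`. -/
noncomputable def partialSum (f : ℂ → ℂ) (a : ℕ → ℂ) (A : Finset ℕ) (z : ℂ) : ℂ :=
  ∑ n ∈ A, a n * (boundaryMap f)^[n] z

end InnerIterates

/-! Write `m` for `circleMeasure`, `φ` for the boundary map and `c = conj (f' 0)`. The heart of the
matter is that `E[z | φ] = c φ`. It comes from moments: by the mean value property, `φ ^ l`, `z φ ^
l` and `conj z φ ^ l` integrate to the values at `0` of `f ^ l`, `z f ^ l` and `f ^ l / z` (the last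
for `l ≥ 1`), so `φ` carries the density `1 + Re (w z)` to `1 + Re (w c z)`
(`IsInner.map_boundaryMap_tiltedMeasure`). The case `w = 0` is invariance of `m`.

Iterating, for `n ≤ j ≤ J` the conditional expectation of `φ^[n] conj (φ^[j])` given `φ^[J]` is the
constant `c ^ (j - n)` (`integral_iterate_mul_conj_iterate_mul`). Expanding the square, `|ξ_k|²` is
uncorrelated with every integrable function of `φ^[J]` once `J ≥ max A_k`
(`integral_norm_sq_iterateSum_mul`). The later blocks form such a function, so the blocks can be
split off one at a time. -/

namespace InnerIterates

open scoped ComplexConjugate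

/-! ### Moments of measures on the circle. -/

/-- Two finite measures carried by the unit circle with the same analytic moments have the same
mixed moments. -/
lemma integral_pow_mul_conj_pow_eq {μ ν : Measure ℂ} (hμ : ∀ᵐ z ∂μ, ‖z‖ = 1)
    (hν : ∀ᵐ z ∂ν, ‖z‖ = 1) (h : ∀ l : ℕ, ∫ z, z ^ l ∂μ = ∫ z, z ^ l ∂ν) (j k : ℕ) :
    ∫ z, z ^ j * conj z ^ k ∂μ = ∫ z, z ^ j * conj z ^ k ∂ν := by
  have key : ∀ z : ℂ, ‖z‖ = 1 → z * conj z = 1 := fun z hz => by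
    rw [Complex.mul_conj, Complex.normSq_eq_norm_sq, hz]; simp
  rcases le_total k j with hkj | hjk
  · obtain ⟨d, rfl⟩ := Nat.exists_eq_add_of_le hkj
    have e : ∀ z : ℂ, ‖z‖ = 1 → z ^ (k + d) * conj z ^ k = z ^ d := fun z hz => by
      rw [pow_add, mul_right_comm, ← mul_pow, key z hz, one_pow, one_mul]
    rw [integral_congr_ae (hμ.mono e), integral_congr_ae (hν.mono e), h]
  · obtain ⟨d, rfl⟩ := Nat.exists_eq_add_of_le hjk
    have e : ∀ z : ℂ, ‖z‖ = 1 → z ^ j * conj z ^ (j + d) = conj (z ^ d) := fun z hz => by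
      rw [pow_add, ← mul_assoc, ← mul_pow, key z hz, one_pow, one_mul, map_pow]
    rw [integral_congr_ae (hμ.mono e), integral_congr_ae (hν.mono e), integral_conj, integral_conj,
      h]

lemma integrable_pow_mul_conj_pow {μ : Measure ℂ} [IsFiniteMeasure μ] (hμ : ∀ᵐ z ∂μ, ‖z‖ = 1)
    (j k : ℕ) : Integrable (fun z : ℂ => z ^ j * conj z ^ k) μ :=
  Integrable.of_bound (by fun_prop) 1 (hμ.mono fun z hz => by simp [hz])

/-- Finite measures carried by the unit circle are determined by their analytic moments. -/
lemma ext_of_integral_pow_eq {μ ν : Measure ℂ} [IsFiniteMeasure μ] [IsFiniteMeasure ν]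
    (hμ : ∀ᵐ z ∂μ, ‖z‖ = 1) (hν : ∀ᵐ z ∂ν, ‖z‖ = 1)
    (h : ∀ l : ℕ, ∫ z, z ^ l ∂μ = ∫ z, z ^ l ∂ν) : μ = ν := by
  refine Measure.ext_of_charFun (funext fun t => ?_)
  have hin : ∀ x : ℂ, ((inner ℝ x t : ℝ) : ℂ) = (t * conj x + conj t * x) / 2 := fun x => by
    apply Complex.ext <;> simp [Complex.inner]; ring
  -- The exponential series of the characteristic function integrates term by term, since `|⟪x, t⟫|
  -- ≤ ‖t‖` on the circle; each term is then a combination of mixed moments.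
  have expand : ∀ ρ : Measure ℂ, IsFiniteMeasure ρ → (∀ᵐ z ∂ρ, ‖z‖ = 1) →
      HasSum (fun n : ℕ => ∫ x, (((inner ℝ x t : ℝ) : ℂ) * Complex.I) ^ n / (n.factorial : ℂ) ∂ρ)
        (charFun ρ t) := by
    intro ρ _ hρ
    rw [charFun_apply]
    refine hasSum_integral_of_dominated_convergence (fun n _ => ‖t‖ ^ n / n.factorial) ?_ ?_ ?_ ?_ ?_
    · intro n
      exact Continuous.aestronglyMeasurable (by fun_prop)
    · intro n
      filter_upwards [hρ] with x hx
      rw [norm_div, norm_pow, norm_mul, Complex.norm_I, mul_one, Complex.norm_real,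
        Complex.norm_natCast]
      gcongr
      simpa [hx] using norm_inner_le_norm (𝕜 := ℝ) x t
    · exact Eventually.of_forall fun _ => Real.summable_pow_div_factorial _
    · exact integrable_const _
    · exact Eventually.of_forall fun x => by
        rw [Complex.exp_eq_exp_ℂ]
        exact NormedSpace.expSeries_div_hasSum_exp _
  have term : ∀ ρ : Measure ℂ, IsFiniteMeasure ρ → (∀ᵐ z ∂ρ, ‖z‖ = 1) → ∀ n : ℕ,
      ∫ x, (((inner ℝ x t : ℝ) : ℂ) * Complex.I) ^ n / (n.factorial : ℂ) ∂ρ =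
        ∑ m ∈ Finset.range (n + 1), (Complex.I / 2) ^ n / (n.factorial : ℂ) * (t ^ m *
          conj t ^ (n - m) * n.choose m) * ∫ z, z ^ (n - m) * conj z ^ m ∂ρ := by
    intro ρ _ hρ n
    simp_rw [← integral_const_mul]
    rw [← integral_finsetSum _ fun m _ => (integrable_pow_mul_conj_pow hρ _ _).const_mul _]
    congr 1
    ext x
    rw [hin, div_mul_eq_mul_div, mul_div_assoc, mul_pow, add_pow, Finset.sum_mul, Finset.sum_div]
    refine Finset.sum_congr rfl fun m _ => ?_
    rw [mul_pow, mul_pow]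
    ring
  refine (expand μ ‹_› hμ).unique ?_
  convert expand ν ‹_› hν using 1
  ext n
  rw [term μ ‹_› hμ, term ν ‹_› hν]
  simp_rw [integral_pow_mul_conj_pow_eq hμ hν h]

/-! ### Arc length and the mean value property for radial limits. -/

instance : IsProbabilityMeasure circleMeasure := by
  refine ⟨?_⟩
  rw [circleMeasure, Measure.map_apply (continuous_circleMap 0 1).measurable MeasurableSet.univ]
  simp only [Set.preimage_univ, Measure.smul_apply, Measure.restrict_apply_univ, Real.volume_Ioc,
    sub_zero, smul_eq_mul]
  exact ENNReal.inv_mul_cancel (by simp [Real.pi_pos]) ENNReal.ofReal_ne_top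

lemma ae_norm_eq_one : ∀ᵐ z ∂circleMeasure, ‖z‖ = 1 := by
  rw [circleMeasure, ae_map_iff (continuous_circleMap 0 1).measurable.aemeasurable
    (measurableSet_eq_fun measurable_norm measurable_const)]
  exact Eventually.of_forall fun θ => by simp

lemma integral_circleMeasure {h : ℂ → ℂ} (hh : AEStronglyMeasurable h circleMeasure) :
    ∫ z, h z ∂circleMeasure = Real.circleAverage h 0 1 := by
  rw [circleMeasure] at hh ⊢
  rw [integral_map (continuous_circleMap 0 1).measurable.aemeasurable hh, integral_smul_measure,
    Real.circleAverage_def, intervalIntegral.integral_of_le Real.two_pi_pos.le, ENNReal.toReal_inv,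
    ENNReal.toReal_ofReal Real.two_pi_pos.le]

lemma aestronglyMeasurable_dilate {g : ℂ → ℂ} (hg : ContinuousOn g (Metric.ball 0 1)) {r : ℝ}
    (hr : r ∈ Set.Ioo (0 : ℝ) 1) :
    AEStronglyMeasurable (fun z => g ((r : ℂ) * z)) circleMeasure := by
  -- The dilate is known to be continuous only near the circle, so the measure is first confined to
  -- it.
  have hm : circleMeasure.restrict (Metric.sphere 0 1) = circleMeasure :=
    Measure.restrict_eq_self_of_ae_mem (ae_norm_eq_one.mono fun z hz => by simpa using hz)
  rw [← hm]
  refine ContinuousOn.aestronglyMeasurable ?_ Metric.isClosed_sphere.measurableSet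
  refine hg.comp (by fun_prop) fun z hz => ?_
  simp only [mem_sphere_iff_norm, sub_zero] at hz
  simp [hz, abs_of_pos hr.1, hr.2]

/-- Mean value property for bounded analytic functions in terms of their radial limits. -/
lemma integral_radialLimit {g G : ℂ → ℂ} (hg : DifferentiableOn ℂ g (Metric.ball 0 1)) {C : ℝ}
    (hC : ∀ z ∈ Metric.ball (0 : ℂ) 1, ‖g z‖ ≤ C)
    (hG : ∀ᵐ z ∂circleMeasure, Tendsto (fun r : ℝ => g ((r : ℂ) * z)) (𝓝[<] 1) (𝓝 (G z))) :
    ∫ z, G z ∂circleMeasure = g 0 := by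
  have hev : ∀ᶠ r : ℝ in 𝓝[<] 1, r ∈ Set.Ioo (0 : ℝ) 1 := Ioo_mem_nhdsLT one_pos
  have hlim : Tendsto (fun r : ℝ => ∫ z, g ((r : ℂ) * z) ∂circleMeasure) (𝓝[<] 1)
      (𝓝 (∫ z, G z ∂circleMeasure)) := by
    refine tendsto_integral_filter_of_dominated_convergence (fun _ => C) ?_ ?_
      (integrable_const _) hG
    · exact hev.mono fun r hr => aestronglyMeasurable_dilate hg.continuousOn hr
    · filter_upwards [hev] with r hr
      filter_upwards [ae_norm_eq_one] with z hz
      exact hC _ (by simp [hz, abs_of_pos hr.1, hr.2])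
  refine tendsto_nhds_unique hlim (tendsto_const_nhds.congr' ?_)
  filter_upwards [hev] with r hr
  rw [integral_circleMeasure (aestronglyMeasurable_dilate hg.continuousOn hr)]
  have hd : DiffContOnCl ℂ g (Metric.ball 0 |r|) := by
    refine DifferentiableOn.diffContOnCl (hg.mono ?_)
    rw [abs_of_pos hr.1]
    exact Metric.closure_ball_subset_closedBall.trans (Metric.closedBall_subset_ball hr.2)
  rw [← hd.circleAverage, Real.circleAverage_def, Real.circleAverage_def]
  simp [circleMap]

/-! ### Moments of the boundary map. -/

section Boundary

variable {f : ℂ → ℂ}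

lemma IsInner.ae_tendsto (hf : IsInner f) : ∀ᵐ z ∂circleMeasure,
    ‖boundaryMap f z‖ = 1 ∧
      Tendsto (fun r : ℝ => f ((r : ℂ) * z)) (𝓝[<] 1) (𝓝 (boundaryMap f z)) := by
  filter_upwards [hf.radial] with z ⟨w, hw, hlim⟩
  rw [boundaryMap, hlim.limUnder_eq]
  exact ⟨hw, hlim⟩

lemma IsInner.aemeasurable_boundaryMap (hf : IsInner f) :
    AEMeasurable (boundaryMap f) circleMeasure := by
  obtain ⟨u, -, hu, hlim⟩ := exists_seq_strictMono_tendsto' (zero_lt_one' ℝ)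
  have hlim' : Tendsto u atTop (𝓝[<] 1) :=
    tendsto_nhdsWithin_iff.2 ⟨hlim, Eventually.of_forall fun n => (hu n).2⟩
  refine aemeasurable_of_tendsto_metrizable_ae atTop
    (f := fun n z => f ((u n : ℂ) * z))
    (fun n => (aestronglyMeasurable_dilate hf.analytic.continuousOn (hu n)).aemeasurable) ?_
  filter_upwards [hf.ae_tendsto] with z hz
  exact hz.2.comp hlim'

lemma IsInner.norm_le_one (hf : IsInner f) : ∀ z ∈ Metric.ball (0 : ℂ) 1, ‖f z‖ ≤ 1 :=
  fun z hz => (by simpa using hf.mapsTo hz : ‖f z‖ < 1).le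

lemma tendsto_ofReal_mul (z : ℂ) : Tendsto (fun r : ℝ => (r : ℂ) * z) (𝓝[<] 1) (𝓝 z) := by
  have : Tendsto (fun r : ℝ => (r : ℂ) * z) (𝓝 1) (𝓝 (((1 : ℝ) : ℂ) * z)) :=
    Continuous.tendsto (by fun_prop) 1
  simpa using this.mono_left nhdsWithin_le_nhds

lemma IsInner.integral_boundaryMap_pow (hf : IsInner f) (l : ℕ) :
    ∫ z, boundaryMap f z ^ l ∂circleMeasure = f 0 ^ l := by
  refine integral_radialLimit (g := fun z => f z ^ l) (hf.analytic.pow l) (C := 1) ?_ ?_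
  · intro z hz
    rw [norm_pow]
    exact pow_le_one₀ (norm_nonneg _) (hf.norm_le_one z hz)
  · filter_upwards [hf.ae_tendsto] with z hz
    exact hz.2.pow l

lemma IsInner.integral_mul_boundaryMap_pow (hf : IsInner f) (l : ℕ) :
    ∫ z, z * boundaryMap f z ^ l ∂circleMeasure = 0 := by
  have := integral_radialLimit (g := fun z => z * f z ^ l) (G := fun z => z * boundaryMap f z ^ l)
    (differentiableOn_id.mul (hf.analytic.pow l)) (C := 1) ?_ ?_
  · simpa using this
  · intro z hz
    rw [norm_mul, norm_pow]
    exact mul_le_one₀ (by simpa using (mem_ball_zero_iff.1 hz).le) (by positivity)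
      (pow_le_one₀ (norm_nonneg _) (hf.norm_le_one z hz))
  · filter_upwards [hf.ae_tendsto] with z hz
    exact (tendsto_ofReal_mul z).mul (hz.2.pow l)

/-- On the circle `conj z = z⁻¹`, so for `l ≥ 1` the integrand is the radial limit of `f ^ l / z`,
that is of `dslope f 0 * f ^ (l - 1)`. This is bounded by the Schwarz lemma, and at `0` it equals
`f' 0 * 0 ^ (l - 1)`. -/
lemma IsInner.integral_conj_mul_boundaryMap_pow (hf : IsInner f) (hf0 : f 0 = 0) (l : ℕ) :
    ∫ z, conj z * boundaryMap f z ^ l ∂circleMeasure = if l = 1 then deriv f 0 else 0 := by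
  rcases l with _ | l
  · have := hf.integral_mul_boundaryMap_pow 0
    simp only [pow_zero, mul_one] at this ⊢
    rw [integral_conj, this]
    simp
  have hmaps : Set.MapsTo f (Metric.ball 0 1) (Metric.closedBall (f 0) 1) := by
    rw [hf0]
    exact hf.mapsTo.mono_right Metric.ball_subset_closedBall
  have := integral_radialLimit (g := fun z => dslope f 0 z * f z ^ l)
    (G := fun z => conj z * boundaryMap f z ^ (l + 1))
    (((Complex.differentiableOn_dslope (Metric.ball_mem_nhds 0 one_pos)).2 hf.analytic).mul
      (hf.analytic.pow l)) (C := 1) ?_ ?_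
  · rw [this, dslope_same, hf0]
    rcases eq_or_ne l 0 with rfl | hl <;> simp [*]
  · intro z hz
    rw [norm_mul, norm_pow]
    refine mul_le_one₀ ?_ (by positivity) (pow_le_one₀ (norm_nonneg _) (hf.norm_le_one z hz))
    simpa using Complex.norm_dslope_le_div_of_mapsTo_ball hf.analytic hmaps hz
  · filter_upwards [hf.ae_tendsto, ae_norm_eq_one] with z hz hz1
    have hz0 : z ≠ 0 := norm_ne_zero_iff.1 (by simp [hz1])
    have hconj : conj z = z⁻¹ := by
      rw [Complex.inv_def, Complex.normSq_eq_norm_sq, hz1]; simp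
    have h1 : Tendsto (fun r : ℝ => ((r : ℂ) * z)⁻¹ * f ((r : ℂ) * z) ^ (l + 1)) (𝓝[<] 1)
        (𝓝 (conj z * boundaryMap f z ^ (l + 1))) := by
      rw [hconj]
      exact ((tendsto_ofReal_mul z).inv₀ hz0).mul (hz.2.pow (l + 1))
    refine h1.congr' ?_
    filter_upwards [Ioo_mem_nhdsLT (zero_lt_one' ℝ)] with r hr
    have hrz : (r : ℂ) * z ≠ 0 := mul_ne_zero (by exact_mod_cast hr.1.ne') hz0
    rw [dslope_of_ne _ hrz, slope_def_field, hf0, sub_zero, sub_zero, div_eq_inv_mul]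
    ring

end Boundary

/-! ### Tilted measures and the conditional expectation of `z`. -/

lemma one_add_re_nonneg {w z : ℂ} (hw : ‖w‖ ≤ 1) (hz : ‖z‖ = 1) : 0 ≤ 1 + (w * z).re := by
  have h1 := Complex.abs_re_le_norm (w * z)
  rw [norm_mul, hz, mul_one] at h1
  linarith [neg_abs_le (w * z).re]

/-- The measure with density `1 + Re (w z)` on the unit circle. -/
noncomputable def tiltedMeasure (w : ℂ) : Measure ℂ :=
  circleMeasure.withDensity fun z => ENNReal.ofReal (1 + (w * z).re)

lemma tiltedMeasure_zero : tiltedMeasure 0 = circleMeasure := by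
  simp [tiltedMeasure]

lemma tiltedMeasure_absolutelyContinuous (w : ℂ) : tiltedMeasure w ≪ circleMeasure :=
  withDensity_absolutelyContinuous _ _

instance (w : ℂ) : IsFiniteMeasure (tiltedMeasure w) := by
  refine isFiniteMeasure_withDensity_ofReal (Integrable.of_bound (C := 1 + ‖w‖) ?_ ?_).2
  · exact Continuous.aestronglyMeasurable (by fun_prop)
  · filter_upwards [ae_norm_eq_one] with z hz
    refine (norm_add_le _ _).trans ?_
    have h1 := Complex.abs_re_le_norm (w * z)
    rw [norm_mul, hz, mul_one] at h1
    simpa using h1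

lemma integral_tiltedMeasure {w : ℂ} (hw : ‖w‖ ≤ 1) (h : ℂ → ℂ) :
    ∫ z, h z ∂tiltedMeasure w = ∫ z, (1 + (w * z).re) • h z ∂circleMeasure := by
  rw [tiltedMeasure, integral_withDensity_eq_integral_toReal_smul (by fun_prop) (by simp)]
  refine integral_congr_ae ?_
  filter_upwards [ae_norm_eq_one] with z hz
  rw [ENNReal.toReal_ofReal (one_add_re_nonneg hw hz)]

lemma integrable_mul_of_norm_eq_one {h u : ℂ → ℂ} (hh : Integrable h circleMeasure)
    (hu : AEStronglyMeasurable u circleMeasure) (hu1 : ∀ᵐ z ∂circleMeasure, ‖u z‖ = 1) :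
    Integrable (fun z => u z * h z) circleMeasure :=
  hh.bdd_mul (c := 1) hu (hu1.mono fun _ h => h.le)

lemma integral_tiltedMeasure_eq_add {w : ℂ} (hw : ‖w‖ ≤ 1) {h : ℂ → ℂ}
    (hh : Integrable h circleMeasure) :
    ∫ z, h z ∂tiltedMeasure w = ∫ z, h z ∂circleMeasure +
      (w / 2 * ∫ z, z * h z ∂circleMeasure + conj w / 2 * ∫ z, conj z * h z ∂circleMeasure) := by
  have h1 : Integrable (fun z => z * h z) circleMeasure :=
    integrable_mul_of_norm_eq_one (u := fun z => z) hh (by fun_prop) ae_norm_eq_one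
  have h2 : Integrable (fun z => conj z * h z) circleMeasure :=
    integrable_mul_of_norm_eq_one (u := fun z => conj z) hh (by fun_prop)
      (ae_norm_eq_one.mono fun z hz => by simpa using hz)
  rw [integral_tiltedMeasure hw, ← integral_const_mul, ← integral_const_mul,
    ← integral_add (h1.const_mul _) (h2.const_mul _),
    ← integral_add (g := fun z => w / 2 * (z * h z) + conj w / 2 * (conj z * h z)) hh
      ((h1.const_mul _).add (h2.const_mul _))]
  congr 1
  ext z
  rw [Complex.real_smul, Complex.ofReal_add, Complex.re_eq_add_conj]
  simp only [Complex.ofReal_one, map_mul]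
  ring

lemma isInner_id : IsInner fun z => z where
  analytic := differentiableOn_id
  mapsTo := fun _ h => h
  radial := ae_norm_eq_one.mono fun z hz => ⟨z, hz, tendsto_ofReal_mul z⟩

lemma boundaryMap_id (z : ℂ) : boundaryMap (fun z => z) z = z :=
  (tendsto_ofReal_mul z).limUnder_eq

section Boundary

variable {f : ℂ → ℂ}

lemma IsInner.integral_boundaryMap_pow_tiltedMeasure (hf : IsInner f) (hf0 : f 0 = 0) {w : ℂ}
    (hw : ‖w‖ ≤ 1) (l : ℕ) :
    ∫ z, boundaryMap f z ^ l ∂tiltedMeasure w =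
      0 ^ l + conj w / 2 * if l = 1 then deriv f 0 else 0 := by
  have hint : Integrable (fun z => boundaryMap f z ^ l) circleMeasure :=
    Integrable.of_bound (hf.aemeasurable_boundaryMap.pow_const l).aestronglyMeasurable 1
      (hf.ae_tendsto.mono fun z hz => by simp [hz.1])
  rw [integral_tiltedMeasure_eq_add hw hint, hf.integral_boundaryMap_pow,
    hf.integral_mul_boundaryMap_pow, hf.integral_conj_mul_boundaryMap_pow hf0, hf0]
  ring

lemma integral_pow_tiltedMeasure {w : ℂ} (hw : ‖w‖ ≤ 1) (l : ℕ) :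
    ∫ z, z ^ l ∂tiltedMeasure w = 0 ^ l + conj w / 2 * if l = 1 then 1 else 0 := by
  simpa only [boundaryMap_id, deriv_id''] using
    isInner_id.integral_boundaryMap_pow_tiltedMeasure rfl hw l

lemma IsInner.norm_deriv_zero_le_one (hf : IsInner f) (hf0 : f 0 = 0) : ‖deriv f 0‖ ≤ 1 :=
  Complex.norm_deriv_le_one_of_mapsTo_ball hf.analytic
    (by simpa only [hf0] using hf.mapsTo.mono_right Metric.ball_subset_closedBall) one_pos

/-- The boundary map of an inner function fixing the origin sends the density `1 + Re (w z)` to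
`1 + Re (w c z)` with `c` the conjugate of `f' 0`. -/
lemma IsInner.map_boundaryMap_tiltedMeasure (hf : IsInner f) (hf0 : f 0 = 0) {w : ℂ}
    (hw : ‖w‖ ≤ 1) :
    (tiltedMeasure w).map (boundaryMap f) = tiltedMeasure (w * conj (deriv f 0)) := by
  have hmeas : AEMeasurable (boundaryMap f) (tiltedMeasure w) :=
    hf.aemeasurable_boundaryMap.mono_ac (tiltedMeasure_absolutelyContinuous w)
  have hwc : ‖w * conj (deriv f 0)‖ ≤ 1 := by
    rw [norm_mul, RCLike.norm_conj]
    exact mul_le_one₀ hw (norm_nonneg _) (hf.norm_deriv_zero_le_one hf0)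
  refine ext_of_integral_pow_eq ?_ ?_ fun l => ?_
  · rw [ae_map_iff hmeas (measurableSet_eq_fun measurable_norm measurable_const)]
    exact (tiltedMeasure_absolutelyContinuous w).ae_le (hf.ae_tendsto.mono fun z hz => hz.1)
  · exact (tiltedMeasure_absolutelyContinuous _).ae_le ae_norm_eq_one
  · rw [integral_map hmeas (by fun_prop), hf.integral_boundaryMap_pow_tiltedMeasure hf0 hw,
      integral_pow_tiltedMeasure hwc]
    split_ifs
    · simp; ring
    · simp

lemma IsInner.map_boundaryMap (hf : IsInner f) (hf0 : f 0 = 0) :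
    circleMeasure.map (boundaryMap f) = circleMeasure := by
  simpa [tiltedMeasure_zero] using hf.map_boundaryMap_tiltedMeasure hf0 (w := 0) (by simp)

lemma IsInner.integrable_comp_boundaryMap (hf : IsInner f) (hf0 : f 0 = 0) {q : ℂ → ℂ}
    (hq : Integrable q circleMeasure) :
    Integrable (fun z => q (boundaryMap f z)) circleMeasure := by
  rw [← hf.map_boundaryMap hf0] at hq
  exact hq.comp_aemeasurable hf.aemeasurable_boundaryMap

lemma integrable_re_smul (w : ℂ) {q : ℂ → ℂ} (hq : Integrable q circleMeasure) :
    Integrable (fun z => (w * z).re • q z) circleMeasure := by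
  refine hq.bdd_smul (φ := fun z : ℂ => (w * z).re) ‖w‖
    (Continuous.aestronglyMeasurable (by fun_prop)) ?_
  filter_upwards [ae_norm_eq_one] with z hz
  simpa [hz] using Complex.abs_re_le_norm (w * z)

/-- This is the transport of tilted measures minus the invariance of `m`. -/
lemma IsInner.integral_re_smul_comp_boundaryMap (hf : IsInner f) (hf0 : f 0 = 0) {w : ℂ}
    (hw : ‖w‖ ≤ 1) {q : ℂ → ℂ} (hq : Integrable q circleMeasure) :
    ∫ z, (w * z).re • q (boundaryMap f z) ∂circleMeasure =
      ∫ z, (w * conj (deriv f 0) * z).re • q z ∂circleMeasure := by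
  have hcomp := hf.integrable_comp_boundaryMap hf0 hq
  have hinv : ∫ z, q (boundaryMap f z) ∂circleMeasure = ∫ z, q z ∂circleMeasure := by
    conv_rhs => rw [← hf.map_boundaryMap hf0]
    rw [integral_map hf.aemeasurable_boundaryMap]
    rw [hf.map_boundaryMap hf0]
    exact hq.aestronglyMeasurable
  have hwc : ‖w * conj (deriv f 0)‖ ≤ 1 := by
    rw [norm_mul, RCLike.norm_conj]
    exact mul_le_one₀ hw (norm_nonneg _) (hf.norm_deriv_zero_le_one hf0)
  have key : ∫ z, q (boundaryMap f z) ∂tiltedMeasure w =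
      ∫ z, q z ∂tiltedMeasure (w * conj (deriv f 0)) := by
    rw [← hf.map_boundaryMap_tiltedMeasure hf0 hw, integral_map
      (hf.aemeasurable_boundaryMap.mono_ac (tiltedMeasure_absolutelyContinuous w))]
    rw [hf.map_boundaryMap_tiltedMeasure hf0 hw]
    exact hq.aestronglyMeasurable.mono_ac (tiltedMeasure_absolutelyContinuous _)
  rw [integral_tiltedMeasure hw, integral_tiltedMeasure hwc] at key
  simp_rw [add_smul, one_smul] at key
  rw [integral_add hcomp (integrable_re_smul w hcomp), integral_add hq (integrable_re_smul _ hq),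
    hinv] at key
  exact add_left_cancel key

/-- The conditional expectation of the identity given the boundary map of `f` is the multiple
`conj (f' 0)` of the boundary map. -/
lemma IsInner.integral_mul_comp_boundaryMap (hf : IsInner f) (hf0 : f 0 = 0) {q : ℂ → ℂ}
    (hq : Integrable q circleMeasure) :
    ∫ z, z * q (boundaryMap f z) ∂circleMeasure =
      conj (deriv f 0) * ∫ z, z * q z ∂circleMeasure := by
  -- `Im (u z) = Re (-i u z)`, so the real statement with `w = 1` and `w = -i` recovers the complex
  -- one.
  have decomp : ∀ (u : ℂ) {h : ℂ → ℂ}, Integrable h circleMeasure →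
      ∫ z, u * z * h z ∂circleMeasure = ∫ z, (1 * u * z).re • h z ∂circleMeasure +
        Complex.I * ∫ z, (-Complex.I * u * z).re • h z ∂circleMeasure := by
    intro u h hh
    rw [← integral_const_mul, ← integral_add (integrable_re_smul _ hh)
      ((integrable_re_smul _ hh).const_mul _)]
    congr 1
    ext z
    have hre : (-Complex.I * u * z).re = (u * z).im := by simp
    rw [hre, one_mul, Complex.real_smul, Complex.real_smul]
    conv_lhs => rw [← Complex.re_add_im (u * z)]
    ring
  have h1 := hf.integral_re_smul_comp_boundaryMap hf0 (w := 1) (by simp) hq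
  have h2 := hf.integral_re_smul_comp_boundaryMap hf0 (w := -Complex.I) (by simp) hq
  have h3 := decomp 1 (hf.integrable_comp_boundaryMap hf0 hq)
  simp only [mul_one] at h3
  rw [h1, h2, ← decomp _ hq] at h3
  simpa only [one_mul, mul_assoc, integral_const_mul] using h3

end Boundary

/-! ### Correlations of iterates of a measure-preserving map. -/

section Transfer

variable {m : Measure ℂ} {g : ℂ → ℂ} {c : ℂ}

lemma ae_norm_iterate_eq_one (hm : ∀ᵐ z ∂m, ‖z‖ = 1) (hg : MeasurePreserving g m m) (n : ℕ) :
    ∀ᵐ z ∂m, ‖g^[n] z‖ = 1 :=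
  (hg.iterate n).quasiMeasurePreserving.ae hm

lemma integral_comp_iterate (hg : MeasurePreserving g m m) {E : Type*} [NormedAddCommGroup E]
    [NormedSpace ℝ E] {q : ℂ → E} (hq : Integrable q m) (k : ℕ) :
    ∫ z, q (g^[k] z) ∂m = ∫ z, q z ∂m := by
  have h := (hg.iterate k).map_eq
  conv_rhs => rw [← h]
  rw [integral_map (hg.iterate k).measurable.aemeasurable]
  rw [h]
  exact hq.aestronglyMeasurable

lemma integral_mul_comp_iterate (hg : MeasurePreserving g m m)
    (hc : ∀ q : ℂ → ℂ, Integrable q m → ∫ z, z * q (g z) ∂m = c * ∫ z, z * q z ∂m)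
    {q : ℂ → ℂ} (hq : Integrable q m) (k : ℕ) :
    ∫ z, z * q (g^[k] z) ∂m = c ^ k * ∫ z, z * q z ∂m := by
  induction k with
  | zero => simp
  | succ k ih =>
    simp only [Function.iterate_succ_apply]
    rw [hc (fun z => q (g^[k] z)) ((hg.iterate k).integrable_comp_of_integrable hq), ih, pow_succ]
    ring

lemma integrable_iterate_mul_conj_iterate_mul (hm : ∀ᵐ z ∂m, ‖z‖ = 1)
    (hg : MeasurePreserving g m m) {G : ℂ → ℂ} (hG : Integrable G m) (n j : ℕ) :
    Integrable (fun z => g^[n] z * conj (g^[j] z) * G z) m := by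
  have h1 := (hg.iterate n).measurable
  have h2 := (hg.iterate j).measurable
  refine hG.bdd_mul (c := 1) (f := fun z => g^[n] z * conj (g^[j] z)) ?_ ?_
  · exact (h1.mul (Complex.continuous_conj.measurable.comp h2)).aestronglyMeasurable
  · filter_upwards [ae_norm_iterate_eq_one hm hg n, ae_norm_iterate_eq_one hm hg j] with z hz hz'
    simp [hz, hz']

/-- Invariance reduces to `n = 0`. What multiplies `z` is then a function of `g^[d]`, with `d = j -
n`; replacing `z` by `c ^ d g^[d]` leaves `z * conj z = 1` next to `G`. -/
lemma integral_iterate_mul_conj_iterate_mul (hm : ∀ᵐ z ∂m, ‖z‖ = 1)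
    (hg : MeasurePreserving g m m)
    (hc : ∀ q : ℂ → ℂ, Integrable q m → ∫ z, z * q (g z) ∂m = c * ∫ z, z * q z ∂m)
    {G : ℂ → ℂ} (hG : Integrable G m) {n j J : ℕ} (hnj : n ≤ j) (hjJ : j ≤ J) :
    ∫ z, g^[n] z * conj (g^[j] z) * G (g^[J] z) ∂m = c ^ (j - n) * ∫ z, G z ∂m := by
  obtain ⟨d, rfl⟩ := Nat.exists_eq_add_of_le hnj
  obtain ⟨e, rfl⟩ := Nat.exists_eq_add_of_le hjJ
  have hGe : Integrable (fun z => G (g^[e] z)) m :=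
    (hg.iterate e).integrable_comp_of_integrable hG
  have hq : Integrable (fun z => conj z * G (g^[e] z)) m :=
    hGe.bdd_mul (c := 1) (f := fun z => conj z)
      (Complex.continuous_conj.measurable.aestronglyMeasurable)
      (hm.mono fun z hz => by simp [hz])
  have hq' : Integrable (fun z => z * (conj (g^[d] z) * G (g^[e] (g^[d] z)))) m :=
    Integrable.bdd_mul (c := 1) (f := fun z => z)
      ((hg.iterate d).integrable_comp_of_integrable hq) (by fun_prop) (hm.mono fun z hz => hz.le)
  have hsplit : ∀ z, g^[n] z * conj (g^[n + d] z) * G (g^[n + d + e] z) =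
      (fun z => z * (conj (g^[d] z) * G (g^[e] (g^[d] z)))) (g^[n] z) := fun z => by
    simp only [← Function.iterate_add_apply]
    rw [add_comm n d, add_comm (d + n) e, ← add_assoc, mul_assoc]
  simp_rw [hsplit]
  rw [integral_comp_iterate hg hq' n, integral_mul_comp_iterate hg hc hq, Nat.add_sub_cancel_left,
    ← integral_comp_iterate hg hG e]
  congr 1
  refine integral_congr_ae ?_
  filter_upwards [hm] with z hz
  rw [← mul_assoc, Complex.mul_conj, Complex.normSq_eq_norm_sq, hz]
  simp

/-- The correlation coefficient of two iterates. -/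
lemma exists_integral_iterate_mul_conj_iterate_mul (hm : ∀ᵐ z ∂m, ‖z‖ = 1)
    (hg : MeasurePreserving g m m)
    (hc : ∀ q : ℂ → ℂ, Integrable q m → ∫ z, z * q (g z) ∂m = c * ∫ z, z * q z ∂m) (n j : ℕ) :
    ∃ κ : ℂ, ∀ G : ℂ → ℂ, Integrable G m → ∀ J : ℕ, n ≤ J → j ≤ J →
      ∫ z, g^[n] z * conj (g^[j] z) * G (g^[J] z) ∂m = κ * ∫ z, G z ∂m := by
  rcases le_total n j with h | h
  · exact ⟨_, fun G hG J _ hj => integral_iterate_mul_conj_iterate_mul hm hg hc hG h hj⟩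
  -- Conjugation exchanges the roles of `n` and `j`, at the cost of replacing `G` by `conj G`.
  · refine ⟨conj (c ^ (n - j)), fun G hG J hn _ => ?_⟩
    have hG' : Integrable (fun z => conj (G z)) m := hG.mono
      (Complex.continuous_conj.comp_aestronglyMeasurable hG.1) (by simp)
    have := congrArg conj (integral_iterate_mul_conj_iterate_mul hm hg hc hG' h hn)
    rw [integral_conj, map_mul, Complex.conj_conj, ← integral_conj] at this
    rw [← this]
    congr 1
    ext z
    simp only [map_mul, Complex.conj_conj]
    ring

/-- A linear combination of iterates. -/
def iterateSum (g : ℂ → ℂ) (a : ℕ → ℂ) (A : Finset ℕ) (z : ℂ) : ℂ := ∑ n ∈ A, a n * g^[n] z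

lemma ae_norm_sum_iterate_le (hm : ∀ᵐ z ∂m, ‖z‖ = 1) (hg : MeasurePreserving g m m) (a : ℕ → ℂ)
    (A : Finset ℕ) (s : ℕ → ℕ) :
    ∀ᵐ z ∂m, ‖∑ n ∈ A, a n * g^[s n] z‖ ≤ ∑ n ∈ A, ‖a n‖ := by
  have : ∀ᵐ z ∂m, ∀ n : ℕ, ‖g^[s n] z‖ = 1 :=
    ae_all_iff.2 fun n => ae_norm_iterate_eq_one hm hg (s n)
  filter_upwards [this] with z hz
  exact (norm_sum_le _ _).trans (Finset.sum_le_sum fun n _ => by simp [hz])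

lemma exists_integral_norm_sq_iterateSum_mul (hm : ∀ᵐ z ∂m, ‖z‖ = 1)
    (hg : MeasurePreserving g m m)
    (hc : ∀ q : ℂ → ℂ, Integrable q m → ∫ z, z * q (g z) ∂m = c * ∫ z, z * q z ∂m)
    (a : ℕ → ℂ) (A : Finset ℕ) :
    ∃ κ : ℂ, ∀ G : ℂ → ℂ, Integrable G m → ∀ J : ℕ, (∀ n ∈ A, n ≤ J) →
      ∫ z, ((‖iterateSum g a A z‖ ^ 2 : ℝ) : ℂ) * G (g^[J] z) ∂m = κ * ∫ z, G z ∂m := by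
  choose κ hκ using exists_integral_iterate_mul_conj_iterate_mul hm hg hc
  refine ⟨∑ n ∈ A, ∑ j ∈ A, a n * conj (a j) * κ n j, fun G hG J hJ => ?_⟩
  have hGJ : Integrable (fun z => G (g^[J] z)) m :=
    (hg.iterate J).integrable_comp_of_integrable hG
  have hint : ∀ n j, Integrable
      (fun z => a n * conj (a j) * (g^[n] z * conj (g^[j] z) * G (g^[J] z))) m := fun n j =>
    (integrable_iterate_mul_conj_iterate_mul hm hg hGJ n j).const_mul _
  have hexp : ∀ z, ((‖iterateSum g a A z‖ ^ 2 : ℝ) : ℂ) * G (g^[J] z) =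
      ∑ n ∈ A, ∑ j ∈ A, a n * conj (a j) * (g^[n] z * conj (g^[j] z) * G (g^[J] z)) := fun z => by
    rw [← Complex.normSq_eq_norm_sq, ← Complex.mul_conj, iterateSum, map_sum,
      Finset.sum_mul_sum, Finset.sum_mul]
    refine Finset.sum_congr rfl fun n _ => ?_
    rw [Finset.sum_mul]
    refine Finset.sum_congr rfl fun j _ => ?_
    rw [map_mul]
    ring
  simp_rw [hexp]
  rw [integral_finsetSum _ fun n _ => integrable_finsetSum _ fun j _ => hint n j, Finset.sum_mul]
  refine Finset.sum_congr rfl fun n hn => ?_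
  rw [integral_finsetSum _ fun j _ => hint n j, Finset.sum_mul]
  refine Finset.sum_congr rfl fun j hj => ?_
  rw [integral_const_mul, hκ n j G hG J (hJ n hn) (hJ j hj)]
  ring

/-- `‖∑ a_n g^n‖²` is uncorrelated with every function of a later iterate. -/
lemma integral_norm_sq_iterateSum_mul [IsProbabilityMeasure m] (hm : ∀ᵐ z ∂m, ‖z‖ = 1)
    (hg : MeasurePreserving g m m)
    (hc : ∀ q : ℂ → ℂ, Integrable q m → ∫ z, z * q (g z) ∂m = c * ∫ z, z * q z ∂m)
    (a : ℕ → ℂ) (A : Finset ℕ) {G : ℂ → ℝ} (hG : Integrable G m) {J : ℕ} (hJ : ∀ n ∈ A, n ≤ J) :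
    ∫ z, ‖iterateSum g a A z‖ ^ 2 * G (g^[J] z) ∂m =
      (∫ z, ‖iterateSum g a A z‖ ^ 2 ∂m) * ∫ z, G z ∂m := by
  obtain ⟨κ, hκ⟩ := exists_integral_norm_sq_iterateSum_mul hm hg hc a A
  -- As `κ` does not depend on `G`, the choice `G = 1` identifies it as the integral of the square.
  have h1 := hκ (fun _ => 1) (integrable_const _) J hJ
  have h2 := hκ (fun z => (G z : ℂ)) hG.ofReal J hJ
  simp only [mul_one, integral_const, probReal_univ, one_smul] at h1
  rw [integral_complex_ofReal] at h1
  rw [integral_complex_ofReal, ← h1] at h2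
  simp_rw [← Complex.ofReal_mul] at h2
  rw [integral_complex_ofReal] at h2
  exact_mod_cast h2

/-- The exponent map `s` allows both the original sums (`id`) and the shifted ones (`n ↦ n - J`). -/
lemma integrable_prod_norm_sq_sum_iterate [IsFiniteMeasure m] (hm : ∀ᵐ z ∂m, ‖z‖ = 1)
    (hg : MeasurePreserving g m m) (a : ℕ → ℂ) {p : ℕ} (A : Fin p → Finset ℕ) (s : ℕ → ℕ) :
    Integrable (fun z => ∏ k, ‖∑ n ∈ A k, a n * g^[s n] z‖ ^ 2) m := by
  refine Integrable.of_bound (C := ∏ k, (∑ n ∈ A k, ‖a n‖) ^ 2) ?_ ?_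
  · exact (Finset.measurable_prod _ fun k _ => ((Finset.measurable_sum _ fun n _ =>
      (hg.measurable.iterate (s n)).const_mul _).norm.pow_const 2)).aestronglyMeasurable
  · filter_upwards [ae_all_iff.2 fun k => ae_norm_sum_iterate_le hm hg a (A k) s] with z hz
    rw [Real.norm_of_nonneg (by positivity)]
    exact Finset.prod_le_prod (fun _ _ => by positivity) fun k _ => by
      gcongr
      exact hz k

lemma integral_prod_norm_sq_iterateSum [IsProbabilityMeasure m] (hm : ∀ᵐ z ∂m, ‖z‖ = 1)
    (hg : MeasurePreserving g m m)
    (hc : ∀ q : ℂ → ℂ, Integrable q m → ∫ z, z * q (g z) ∂m = c * ∫ z, z * q z ∂m)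
    (a : ℕ → ℂ) {p : ℕ} (A : Fin p → Finset ℕ)
    (hA : ∀ k l, k < l → ∀ n ∈ A k, ∀ j ∈ A l, n < j) :
    ∫ z, ∏ k, ‖iterateSum g a (A k) z‖ ^ 2 ∂m = ∏ k, ∫ z, ‖iterateSum g a (A k) z‖ ^ 2 ∂m := by
  induction p with
  | zero => simp
  | succ p ih =>
    have ih' := ih (fun k => A k.succ) fun k l hkl => hA _ _ (Fin.succ_lt_succ_iff.2 hkl)
    set J := (A 0).sup id with hJ
    have hJle : ∀ n ∈ A 0, n ≤ J := fun n hn => Finset.le_sup (f := id) hn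
    have hJge : ∀ k : Fin p, ∀ j ∈ A k.succ, J ≤ j := fun k j hj =>
      Finset.sup_le fun n hn => (hA 0 k.succ (Fin.succ_pos k) n hn j hj).le
    -- The later blocks are a function of `g^[J]`: as `J ≤ n` there, the subtraction `n - J` is not
    -- truncated.
    have hG := integrable_prod_norm_sq_sum_iterate hm hg a (fun k : Fin p => A k.succ) (· - J)
    have hshift : ∀ z, ∏ k : Fin p, ‖iterateSum g a (A k.succ) z‖ ^ 2 =
        (fun z => ∏ k : Fin p, ‖∑ n ∈ A k.succ, a n * g^[n - J] z‖ ^ 2) (g^[J] z) := fun z => by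
      refine Finset.prod_congr rfl fun k _ => ?_
      rw [iterateSum]
      congr 2
      refine Finset.sum_congr rfl fun n hn => ?_
      rw [← Function.iterate_add_apply, Nat.sub_add_cancel (hJge k n hn)]
    simp_rw [Fin.prod_univ_succ]
    rw [← ih']
    simp_rw [hshift]
    rw [integral_norm_sq_iterateSum_mul hm hg hc a (A 0) hG hJle, integral_comp_iterate hg hG]

end Transfer

/-! ### Passage to a measurable modification, and the theorem. -/

lemma ae_iterate_eq {m : Measure ℂ} {φ g : ℂ → ℂ} (hg : MeasurePreserving g m m)
    (h : φ =ᵐ[m] g) (n : ℕ) : φ^[n] =ᵐ[m] g^[n] := by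
  induction n with
  | zero => rfl
  | succ n ih =>
    filter_upwards [h, hg.quasiMeasurePreserving.ae_eq ih] with z h1 h2
    rw [Function.iterate_succ_apply, Function.iterate_succ_apply, h1]
    exact h2

end InnerIterates

theorem theorem3 (f : ℂ → ℂ) (hf : InnerIterates.IsInner f) (hf0 : f 0 = 0)
    (a : ℕ → ℂ) (p : ℕ) (A : Fin p → Finset ℕ)
    (hpos : ∀ k : Fin p, ∀ n ∈ A k, 0 < n)
    (hsep : ∀ k l : Fin p, (l : ℕ) = (k : ℕ) + 1 → ∀ n ∈ A k, ∀ j ∈ A l, n < j) :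
    (∀ k : Fin p, Integrable (fun z => ‖InnerIterates.partialSum f a (A k) z‖ ^ 2)
      InnerIterates.circleMeasure) ∧
    Integrable (fun z => ∏ k : Fin p, ‖InnerIterates.partialSum f a (A k) z‖ ^ 2)
      InnerIterates.circleMeasure ∧
    ∫ z, ∏ k : Fin p, ‖InnerIterates.partialSum f a (A k) z‖ ^ 2 ∂InnerIterates.circleMeasure
      = ∏ k : Fin p,
        ∫ z, ‖InnerIterates.partialSum f a (A k) z‖ ^ 2 ∂InnerIterates.circleMeasure := by
  open InnerIterates in
  have hφ := hf.aemeasurable_boundaryMap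
  -- The boundary map is only almost everywhere measurable; `g` is a measurable version, with almost
  -- everywhere the same iterates because it preserves null sets under preimage.
  set g := hφ.mk (boundaryMap f) with hgdef
  have hφg : boundaryMap f =ᵐ[circleMeasure] g := hφ.ae_eq_mk
  have hg : MeasurePreserving g circleMeasure circleMeasure :=
    ⟨hφ.measurable_mk, by rw [← Measure.map_congr hφg, hf.map_boundaryMap hf0]⟩
  have hc : ∀ q : ℂ → ℂ, Integrable q circleMeasure → ∫ z, z * q (g z) ∂circleMeasure =
      starRingEnd ℂ (deriv f 0) * ∫ z, z * q z ∂circleMeasure := fun q hq => by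
    rw [← hf.integral_mul_comp_boundaryMap hf0 hq]
    refine integral_congr_ae ?_
    filter_upwards [hφg] with z hz
    rw [hz]
  have hsum : ∀ k, ∀ᵐ z ∂circleMeasure, partialSum f a (A k) z = iterateSum g a (A k) z := by
    intro k
    filter_upwards [ae_all_iff.2 fun n => ae_iterate_eq hg hφg n] with z hz
    exact Finset.sum_congr rfl fun n _ => by rw [hz n]
  have hsq : ∀ k, (fun z => ‖partialSum f a (A k) z‖ ^ 2) =ᵐ[circleMeasure]
      fun z => ‖iterateSum g a (A k) z‖ ^ 2 := fun k => by
    filter_upwards [hsum k] with z hz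
    rw [hz]
  have hprod : (fun z => ∏ k, ‖partialSum f a (A k) z‖ ^ 2) =ᵐ[circleMeasure]
      fun z => ∏ k, ‖iterateSum g a (A k) z‖ ^ 2 := by
    filter_upwards [ae_all_iff.2 hsum] with z hz
    simp_rw [hz]
  refine ⟨fun k => ?_, ?_, ?_⟩
  · rw [integrable_congr (hsq k)]
    simpa [iterateSum] using integrable_prod_norm_sq_sum_iterate ae_norm_eq_one hg a
      (fun _ : Fin 1 => A k) id
  · rw [integrable_congr hprod]
    exact integrable_prod_norm_sq_sum_iterate ae_norm_eq_one hg a A id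
  -- Separation of consecutive blocks chains to all pairs only through nonempty blocks. An empty
  -- block makes both sides zero.
  by_cases hne : ∀ k, (A k).Nonempty
  -- Here `d` counts the blocks strictly between `k` and `l`.
  · have hlt : ∀ d : ℕ, ∀ k l : Fin p, (l : ℕ) = k + 1 + d → ∀ n ∈ A k, ∀ j ∈ A l, n < j := by
      intro d
      induction d with
      | zero => exact fun k l h => hsep k l h
      | succ d ih =>
        intro k l h n hn j hj
        let i : Fin p := ⟨k + 1 + d, by omega⟩
        obtain ⟨x, hx⟩ := hne i
        exact (ih k i rfl n hn x hx).trans (hsep i l (by simp [i]; omega) x hx j hj)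
    rw [integral_congr_ae hprod]
    simp_rw [fun k => integral_congr_ae (hsq k)]
    exact integral_prod_norm_sq_iterateSum ae_norm_eq_one hg hc a A fun k l hkl =>
      hlt (l - k - 1) k l (by have : (k : ℕ) < l := hkl; omega)
  · obtain ⟨k, hk⟩ := not_forall.1 hne
    have hk0 : ∀ z, ‖partialSum f a (A k) z‖ ^ 2 = 0 := fun z => by
      simp [partialSum, Finset.not_nonempty_iff_eq_empty.1 hk]
    rw [Finset.prod_eq_zero (Finset.mem_univ k) (by simp [hk0])]
    have hz : ∀ z, ∏ k, ‖partialSum f a (A k) z‖ ^ 2 = 0 := fun z =>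
      Finset.prod_eq_zero (Finset.mem_univ k) (hk0 z)
    simp [hz]
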